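/- Let $S$ be a scheme; all schemes, morphisms and fiber products are over $S$. Let a group scheme $G$ act on a scheme $X$ by $\mathrm{act}: G\times X\to X$. A morphism $\mathrm{quo}: X\to Y$ is called an \emph{excellent quotient} of $X$ by $G$ with fibers $F$ if $F$ is a faithfully flat scheme over $S$ and there are an $S$-valued point $\mathrm{pt}: S\to F$ and an isomorphism $\mathrm{iso}: F\times Y\to X$ of schemes over $Y$ such that: (i) $\mathrm{quo}\circ\mathrm{act}=\mathrm{quo}\circ\mathrm{pr}_2$ as morphisms $G\times X\to Y$; (ii) the composition $G\times Y\xrightarrow{(\mathrm{id}_G,\mathrm{pt},\mathrm{id}_Y)} G\times F\times Y\xrightarrow{(\mathrm{id}_G,\mathrm{iso})} G\times X\xrightarrow{\mathrm{act}} X$ is surjective; (iii) for every morphism $Y'\to Y$, with $\mathrm{quo}': X'=X\times_Y Y'\to Y'$ and $\mathrm{act}': G\times X'\to X'$ obtained by base change, the image of the map $\Gamma(Y',\mathcal O_{Y'})\to\Gamma(X',\mathcal O_{X'})$ induced by $\mathrm{quo}'$ is the ring $\Gamma(X',\mathcal O_{X'})^G$ of those functions $f$ with $f\circ\mathrm{act}'=f\circ\mathrm{pr}_2$.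 \textbf{Theorem.} Let $G$ be a group scheme acting on a scheme $X$ by $\mathrm{act}_X: G\times X\to X$. Let $H\subseteq G$ be a normal subgroup scheme (it suffices that $H\to G$ is a monomorphism of group schemes such that $H(T)$ is normal in $G(T)$ for all $T$), acting on $X$ by restriction of $\mathrm{act}_X$, and let $\mathrm{quo}_1: X\to Y$ be an excellent quotient of $X$ by $H$ with fibers $F_1$. Then there is a unique $G$-action $\mathrm{act}_Y: G\times Y\to Y$ on $Y$ such that $\mathrm{quo}_1\circ\mathrm{act}_X=\mathrm{act}_Y\circ(\mathrm{id}_G,\mathrm{quo}_1)$. Moreover, if $\mathrm{quo}_2: Y\to Z$ is an excellent quotient of $Y$ by $G$ (for this action) with fibers $F_2$, then $\mathrm{quo}_2\circ\mathrm{quo}_1: X\to Z$ is an excellent quotient of $X$ by $G$ with fibers $F_1\times F_2$. -/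

import Mathlib

open CategoryTheory MonoidalCategory CartesianMonoidalCategory MonObj AlgebraicGeometry

universe u

noncomputable section

namespace ExcellentQuotient

variable {S : Scheme.{u}}

/-- The morphism `act' : G ×_S X' ⟶ X'` obtained from `act : G ×_S X ⟶ X` by base change along
`Y' ⟶ Y`, where `X' = X ×_Y Y'`. On `T`-valued points it is `g • (x, y') = (g • x, y')`.
It exists because the action is compatible with `quo : X ⟶ Y`. -/
def baseChangeAct {G X Y X' Y' : Over S} {act : G ⊗ X ⟶ X} {quo : X ⟶ Y}
    (hinv : act ≫ quo = snd G X ≫ quo) {p : X' ⟶ X} {quo' : X' ⟶ Y'} {b : Y' ⟶ Y}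
    (sq : IsPullback p quo' quo b) : G ⊗ X' ⟶ X' :=
  sq.lift (G ◁ p ≫ act) (snd G X' ≫ quo') (by
    rw [Category.assoc, hinv, whiskerLeft_snd_assoc, Category.assoc, sq.w])

/-- The set `Γ(X, 𝒪_X)^G` of invariant global functions for a morphism `act : G ×_S X ⟶ X`:
those `f` for which the two composites `f ∘ act` and `f ∘ pr₂`, with `f` regarded as a morphism to
the affine line over `ℤ`, agree, that is, whose pullbacks to `Γ(G ×_S X, 𝒪)` agree. -/
def invariantFunctions {G X : Over S} (act : G ⊗ X ⟶ X) : Set Γ(X.left, ⊤) :=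
  {f | act.left.appTop f = (snd G X).left.appTop f}

/-- `quo : X ⟶ Y` is an excellent quotient of `X` by the group scheme `G`, acting by `a`,
with fibers `F`. Everything is over the base scheme `S`, and `⊗` is the fiber product over `S`. -/
structure IsExcellentQuotient {G X Y : Over S} [GrpObj G] (a : ModObj G X)
    (quo : X ⟶ Y) (F : Over S) : Prop where
  /-- `F` is faithfully flat over `S`: flat ... -/
  flat : Flat F.hom
  /-- ... and surjective. -/
  surjective : Surjective F.hom
  /-- The quotient morphism is invariant. -/
  invariant : a.smul ≫ quo = snd G X ≫ quo
  /-- There are an `S`-valued point `pt` of `F` and an isomorphism `F × Y ≅ X` over `Y` such that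
  `G × Y ⟶ G × F × Y ⟶ G × X ⟶ X`, `(g, y) ↦ g • iso (pt, y)`, is surjective. -/
  exists_iso : ∃ (pt : 𝟙_ (Over S) ⟶ F) (iso : F ⊗ Y ≅ X), iso.hom ≫ quo = snd F Y ∧
    Surjective (G ◁ (lift (toUnit Y ≫ pt) (𝟙 Y)) ≫ G ◁ iso.hom ≫ a.smul).left
  /-- After every base change `Y' ⟶ Y`, the image of `Γ(Y') ⟶ Γ(X')` is the ring of invariants. -/
  range_eq : ∀ ⦃X' Y' : Over S⦄ ⦃p : X' ⟶ X⦄ ⦃quo' : X' ⟶ Y'⦄ ⦃b : Y' ⟶ Y⦄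
    (sq : IsPullback p quo' quo b),
    Set.range quo'.left.appTop = invariantFunctions (baseChangeAct invariant sq)

end ExcellentQuotient

end

/-! The isomorphism `iso` and the point `pt` give a section `s` of the quotient whose translates
cover the total space. The key lemma `comp_section_comp` says that an invariant morphism `φ` on any
base change equals `quo' ≫ σ ≫ φ`, with `σ` induced by `s`: condition (iii) gives this for affine
targets, and covering by translates reduces to them.

By normality, `(g, x) ↦ quo₁ (g • x)` is `H`-invariant, hence descends along `G ◁ quo₁`; this is the
action on `Y`. For the composite quotient, a point of `X` is moved to the section first by `G` on
`Y`, then by `H` in a fiber of `quo₁`, and invariant functions descend in two stages. -/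

namespace ExcellentQuotient

/-! ### Actions in terms of generalized points -/

section PointAction

variable {C : Type*} [Category* C] [CartesianMonoidalCategory C] {G H X Y T T' : C}

/-- The action of `T`-valued points of `G` on `T`-valued points of `X`. -/
def pointSmul [MonObj G] (a : ModObj G X) (g : T ⟶ G) (x : T ⟶ X) : T ⟶ X :=
  lift g x ≫ (a.smul : G ⊗ X ⟶ X)

theorem lift_comp_smul [MonObj G] (a : ModObj G X) (g : T ⟶ G) (x : T ⟶ X) :
    lift g x ≫ (a.smul : G ⊗ X ⟶ X) = pointSmul a g x := rfl

theorem smul_eq_pointSmul [MonObj G] (a : ModObj G X) :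
    (a.smul : G ⊗ X ⟶ X) = pointSmul a (fst G X) (snd G X) := by
  simp [pointSmul]

theorem comp_pointSmul [MonObj G] (a : ModObj G X) (f : T' ⟶ T) (g : T ⟶ G) (x : T ⟶ X) :
    f ≫ pointSmul a g x = pointSmul a (f ≫ g) (f ≫ x) := by
  rw [pointSmul, ← Category.assoc, comp_lift, pointSmul]

theorem one_pointSmul [MonObj G] (a : ModObj G X) (x : T ⟶ X) : pointSmul a 1 x = x := by
  have h : η[G] ▷ X ≫ (a.smul : G ⊗ X ⟶ X) = (λ_ X).hom := a.one_smul
  have := congr(lift (toUnit T) x ≫ $h)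
  rwa [← Category.assoc, lift_whiskerRight, lift_leftUnitor_hom] at this

theorem mul_pointSmul [MonObj G] (a : ModObj G X) (g h : T ⟶ G) (x : T ⟶ X) :
    pointSmul a (g * h) x = pointSmul a g (pointSmul a h x) := by
  have e : μ[G] ▷ X ≫ (a.smul : G ⊗ X ⟶ X) = (α_ G G X).hom ≫ G ◁ a.smul ≫ a.smul := a.mul_smul
  have := congr(lift (lift g h) x ≫ $e)
  rw [← Category.assoc, lift_whiskerRight, lift_lift_associator_hom_assoc] at this
  rw [← Category.assoc, lift_whiskerLeft] at this
  exact this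

/-- A module structure from an action on `T`-valued points. -/
@[reducible]
def modObjOfPoints [MonObj G] (m : G ⊗ X ⟶ X)
    (one : lift 1 (𝟙 X) ≫ m = 𝟙 X)
    (mul : ∀ {T : C} (g h : T ⟶ G) (x : T ⟶ X),
      lift (g * h) x ≫ m = lift g (lift h x ≫ m) ≫ m) : ModObj G X where
  smul := m
  one_smul := by
    change η[G] ▷ X ≫ m = (λ_ X).hom
    have : η[G] ▷ X = snd _ _ ≫ lift 1 (𝟙 X) := by
      ext
      · simp [Hom.one_def, ← Category.assoc, toUnit_unique (snd (𝟙_ C) X ≫ toUnit X) (fst _ _)]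
      · simp
    rw [this, Category.assoc, one, Category.comp_id, leftUnitor_hom]
  mul_smul := by
    change μ[G] ▷ X ≫ m = (α_ G G X).hom ≫ G ◁ m ≫ m
    have e := mul (fst (G ⊗ G) X ≫ fst G G) (fst (G ⊗ G) X ≫ snd G G) (snd (G ⊗ G) X)
    have h₁ : μ[G] ▷ X = lift ((fst (G ⊗ G) X ≫ fst G G) * (fst (G ⊗ G) X ≫ snd G G))
        (snd (G ⊗ G) X) := by
      rw [← MonObj.comp_mul, ← MonObj.mul_eq_mul]
      ext <;> simp
    have h₂ : (α_ G G X).hom ≫ G ◁ m = lift (fst (G ⊗ G) X ≫ fst G G)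
        (lift (fst (G ⊗ G) X ≫ snd G G) (snd (G ⊗ G) X) ≫ m) := by
      ext
      · simp
      · simp only [Category.assoc, whiskerLeft_snd, lift_snd]
        rw [← Category.assoc]
        congr 1
        ext <;> simp
    rw [h₁, e, ← h₂, Category.assoc]

theorem pointSmul_comp [MonObj G] {aX : ModObj G X} {aY : ModObj G Y} {q : X ⟶ Y}
    (h : (aX.smul : G ⊗ X ⟶ X) ≫ q = G ◁ q ≫ (aY.smul : G ⊗ Y ⟶ Y)) (g : T ⟶ G) (x : T ⟶ X) :
    pointSmul aX g x ≫ q = pointSmul aY g (x ≫ q) := by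
  rw [pointSmul, Category.assoc, h, ← Category.assoc, lift_whiskerLeft, pointSmul]

theorem pointSmul_comp_of_invariant [MonObj G] {a : ModObj G X} {q : X ⟶ Y}
    (h : (a.smul : G ⊗ X ⟶ X) ≫ q = snd G X ≫ q) (g : T ⟶ G) (x : T ⟶ X) :
    pointSmul a g x ≫ q = x ≫ q := by
  rw [pointSmul, Category.assoc, h, lift_snd_assoc]

theorem pointSmul_scalarRestriction [MonObj G] [MonObj H] (a : ModObj G X) (j : H ⟶ G)
    [IsMonHom j] (h : T ⟶ H) (x : T ⟶ X) :
    pointSmul (Mod.scalarRestriction j X) h x = pointSmul a (h ≫ j) x := by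
  change lift h x ≫ j ▷ X ≫ (a.smul : G ⊗ X ⟶ X) = _
  rw [← Category.assoc, lift_whiskerRight, pointSmul]

/-- This exhibits `G ◁ q` as a base change of `q`, so that condition (iii) can be used over `G ⊗ Y`.
-/
theorem isPullback_snd_whiskerLeft (G : C) (q : X ⟶ Y) :
    IsPullback (snd G X) (G ◁ q) q (snd G Y) :=
  .of_isLimit' ⟨by simp⟩ <| Limits.PullbackCone.IsLimit.mk _
    (fun s => lift (s.snd ≫ fst G Y) s.fst) (by simp)
    (fun s => by ext <;> simp [s.condition])
    (fun s m h₁ h₂ => by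
      ext
      · simp [← h₂]
      · simp [← h₁])

end PointAction

variable {S : Scheme.{u}}

theorem comp_left_appTop {X Y Z : Over S} (f : X ⟶ Y) (g : Y ⟶ Z) (k : Γ(Z.left, ⊤)) :
    (f ≫ g).left.appTop k = f.left.appTop (g.left.appTop k) := by
  rw [Over.comp_left, Scheme.Hom.comp_appTop]
  rfl

theorem comp_left_apply {X Y Z : Over S} (f : X ⟶ Y) (g : Y ⟶ Z) (x : X.left) :
    (f ≫ g).left x = g.left (f.left x) := by
  rw [Over.comp_left, Scheme.Hom.comp_apply]

theorem surjective_left_of_comp {X Y Z : Over S} (f : X ⟶ Y) (g : Y ⟶ Z)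
    (h : Surjective (f ≫ g).left) : Surjective g.left := by
  rw [Over.comp_left] at h
  exact Surjective.of_comp f.left g.left

theorem surjective_left_of_isPullback {P A B D : Over S} {f : P ⟶ A} {g : P ⟶ B} {h : A ⟶ D}
    {k : B ⟶ D} (sq : IsPullback f g h k) (hk : Surjective k.left) : Surjective f.left :=
  MorphismProperty.of_isPullback (P := @Surjective) (sq.map (Over.forget S)).flip hk

/-! ### Base change of actions -/

section BaseChange

variable {G X Y X' Y' : Over S} {act : G ⊗ X ⟶ X} {quo : X ⟶ Y}
  (hinv : act ≫ quo = snd G X ≫ quo) {p : X' ⟶ X} {quo' : X' ⟶ Y'} {b : Y' ⟶ Y}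
  (sq : IsPullback p quo' quo b)

theorem baseChangeAct_fst : baseChangeAct hinv sq ≫ p = G ◁ p ≫ act := sq.lift_fst _ _ _

theorem baseChangeAct_fst_assoc {Z : Over S} (k : X ⟶ Z) :
    baseChangeAct hinv sq ≫ p ≫ k = G ◁ p ≫ act ≫ k := by
  rw [← Category.assoc, baseChangeAct_fst, Category.assoc]

theorem baseChangeAct_snd : baseChangeAct hinv sq ≫ quo' = snd G X' ≫ quo' := sq.lift_snd _ _ _

theorem baseChangeAct_snd_assoc {Z : Over S} (k : Y' ⟶ Z) :
    baseChangeAct hinv sq ≫ quo' ≫ k = snd G X' ≫ quo' ≫ k := by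
  rw [← Category.assoc, baseChangeAct_snd, Category.assoc]

theorem baseChangeAct_comp {X'' Y'' : Over S} {p' : X'' ⟶ X'} {quo'' : X'' ⟶ Y''} {b' : Y'' ⟶ Y'}
    (sq' : IsPullback p' quo'' quo' b') :
    baseChangeAct hinv (sq'.paste_horiz sq) ≫ p' = G ◁ p' ≫ baseChangeAct hinv sq := by
  apply sq.hom_ext
  · simp [baseChangeAct_fst]
  · rw [Category.assoc, Category.assoc, sq'.w, baseChangeAct_snd_assoc, baseChangeAct_snd, ← sq'.w,
      whiskerLeft_snd_assoc]

end BaseChange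

/-! ### Factorization of invariant morphisms -/

namespace IsExcellentQuotient

variable {G X Y F X' Y' : Over S} [GrpObj G] {a : ModObj G X} {quo : X ⟶ Y}

/-- An excellent quotient has a section whose translates by the group cover the total space. -/
theorem exists_section (h : IsExcellentQuotient a quo F) :
    ∃ s : Y ⟶ X, s ≫ quo = 𝟙 Y ∧ Surjective (G ◁ s ≫ (a.smul : G ⊗ X ⟶ X)).left := by
  obtain ⟨pt, iso, h₁, h₂⟩ := h.exists_iso
  refine ⟨lift (toUnit Y ≫ pt) (𝟙 Y) ≫ iso.hom, by simp [h₁], ?_⟩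
  rwa [MonoidalCategory.whiskerLeft_comp, Category.assoc]

variable {p : X' ⟶ X} {quo' : X' ⟶ Y'} {b : Y' ⟶ Y}

/-- A morphism to an affine scheme is determined by its pullback of global functions. These
pullbacks are invariant, so they come from `Y'`, and pulling back along `σ` recovers them there. -/
theorem comp_section_comp_of_isAffine (h : IsExcellentQuotient a quo F)
    (sq : IsPullback p quo' quo b) {σ : Y' ⟶ X'} (hσ : σ ≫ quo' = 𝟙 Y')
    {Z : Over S} [IsAffine Z.left] (φ : X' ⟶ Z)
    (hφ : baseChangeAct h.invariant sq ≫ φ = snd G X' ≫ φ) : quo' ≫ σ ≫ φ = φ := by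
  ext1
  apply ext_of_isAffine
  ext f
  have hmem : φ.left.appTop f ∈ invariantFunctions (baseChangeAct h.invariant sq) := by
    have := congr(($hφ).left.appTop f)
    rwa [comp_left_appTop, comp_left_appTop] at this
  rw [← h.range_eq sq] at hmem
  obtain ⟨k, hk⟩ := hmem
  have hk' : σ.left.appTop (φ.left.appTop f) = k := by
    rw [← hk, ← comp_left_appTop, hσ, Over.id_left, Scheme.Hom.id_appTop]
    rfl
  change (quo' ≫ σ ≫ φ).left.appTop f = φ.left.appTop f
  rw [comp_left_appTop, comp_left_appTop, hk', hk]

/-- Every invariant morphism out of a base change of an excellent quotient factors through the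
base. -/
theorem comp_section_comp (h : IsExcellentQuotient a quo F)
    (sq : IsPullback p quo' quo b) {s : Y ⟶ X} (hs : s ≫ quo = 𝟙 Y)
    (hsurj : Surjective (G ◁ s ≫ (a.smul : G ⊗ X ⟶ X)).left)
    {σ : Y' ⟶ X'} (hσ : σ ≫ quo' = 𝟙 Y') (hσs : σ ≫ p = b ≫ s)
    {Z : Over S} (φ : X' ⟶ Z)
    (hφ : baseChangeAct h.invariant sq ≫ φ = snd G X' ≫ φ) : quo' ≫ σ ≫ φ = φ := by
  -- The translates of `σ` still cover: their map is the base change of the one for `s`.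
  have hc : Surjective (G ◁ σ ≫ baseChangeAct h.invariant sq).left := by
    have big : IsPullback (G ◁ b) ((G ◁ σ ≫ baseChangeAct h.invariant sq) ≫ quo')
        ((G ◁ s ≫ (a.smul : G ⊗ X ⟶ X)) ≫ quo) b := by
      have e₁ : (G ◁ σ ≫ baseChangeAct h.invariant sq) ≫ quo' = snd G Y' := by
        rw [Category.assoc, baseChangeAct_snd, whiskerLeft_snd_assoc, hσ, Category.comp_id]
      have e₂ : (G ◁ s ≫ (a.smul : G ⊗ X ⟶ X)) ≫ quo = snd G Y := by
        rw [Category.assoc, h.invariant, whiskerLeft_snd_assoc, hs, Category.comp_id]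
      rw [e₁, e₂]
      exact (isPullback_snd_whiskerLeft G b).flip
    refine surjective_left_of_isPullback (IsPullback.of_bot big ?_ sq).flip hsurj
    rw [Category.assoc, baseChangeAct_fst, ← MonoidalCategory.whiskerLeft_comp_assoc,
      ← MonoidalCategory.whiskerLeft_comp_assoc, hσs]
  have hpt (x : X'.left) : (quo' ≫ σ ≫ φ).left x = φ.left x := by
    obtain ⟨t, rfl⟩ := hc.surj x
    have e : (G ◁ σ ≫ baseChangeAct h.invariant sq) ≫ quo' ≫ σ ≫ φ =
        (G ◁ σ ≫ baseChangeAct h.invariant sq) ≫ φ := by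
      rw [Category.assoc, Category.assoc, baseChangeAct_snd_assoc, hφ, whiskerLeft_snd_assoc,
        whiskerLeft_snd_assoc, reassoc_of% hσ]
    have := congr(($e).left t)
    rwa [comp_left_apply, comp_left_apply _ φ] at this
  ext1
  refine Scheme.hom_ext_of_forall _ _ fun x ↦ ?_
  obtain ⟨V, hV, hxV, -⟩ := exists_isAffineOpen_mem_and_subset
    (U := (⊤ : Z.left.Opens)) (x := φ.left x) trivial
  -- By `hpt`, the preimage of `W` in `X'` is that of `V` under `φ`, so over `W` the target may be
  -- replaced by the affine `V`.
  let W : Y'.left.Opens := (σ ≫ φ).left ⁻¹ᵁ V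
  let iW : Over.mk (W.ι ≫ Y'.hom) ⟶ Y' := Over.homMk W.ι
  let iV : Over.mk (V.ι ≫ Z.hom) ⟶ Z := Over.homMk V.ι
  have : IsAffine (Over.mk (V.ι ≫ Z.hom)).left := hV
  have sq' : IsPullback (Limits.pullback.fst quo' iW) (Limits.pullback.snd quo' iW) quo' iW :=
    .of_hasPullback _ _
  set i := Limits.pullback.fst quo' iW
  set q := Limits.pullback.snd quo' iW
  have sqS : IsPullback i.left q.left quo'.left W.ι := sq'.map (Over.forget S)
  have hi : IsOpenImmersion i.left :=
    MorphismProperty.of_isPullback (P := @IsOpenImmersion) sqS.flip inferInstance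
  have hiV (t) : φ.left (i.left t) ∈ V := by
    rw [← hpt]
    have hw : quo'.left (i.left t) ∈ W := by
      rw [← Scheme.Hom.comp_apply, sqS.w, Scheme.Hom.comp_apply]
      exact (q.left t).2
    exact hw
  have hmono : Mono iV := by
    apply Over.mono_of_mono_left
  let ψ : Limits.pullback quo' iW ⟶ Over.mk (V.ι ≫ Z.hom) :=
    Over.homMk (IsOpenImmersion.lift V.ι (i ≫ φ).left (by
      rintro _ ⟨t, rfl⟩
      simpa using hiV t)) (by simp)
  have hψ : ψ ≫ iV = i ≫ φ := by ext1; simp [ψ, iV]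
  have hτ : (iW ≫ σ) ≫ quo' = 𝟙 _ ≫ iW := by simp [hσ]
  have key := h.comp_section_comp_of_isAffine (sq'.paste_horiz sq)
    (σ := sq'.lift (iW ≫ σ) (𝟙 _) hτ) (sq'.lift_snd _ _ _) ψ (by
      rw [← cancel_mono iV, Category.assoc, Category.assoc, hψ,
        ← Category.assoc, baseChangeAct_comp h.invariant sq sq', Category.assoc, hφ, whiskerLeft_snd_assoc])
  have key' : i ≫ quo' ≫ σ ≫ φ = i ≫ φ := by
    have := congr($key ≫ iV)
    rwa [Category.assoc, Category.assoc, hψ, IsPullback.lift_fst_assoc, Category.assoc,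
      ← sq'.w_assoc] at this
  refine ⟨i.left.opensRange, ?_, ?_⟩
  · have hx : quo'.left x ∈ W := by
      change (σ ≫ φ).left (quo'.left x) ∈ V
      rwa [← comp_left_apply, hpt]
    have := Scheme.image_preimage_eq_of_isPullback sqS.flip Set.univ
    simp only [Set.preimage_univ, Set.image_univ] at this
    exact this.ge ⟨⟨_, hx⟩, rfl⟩
  · rw [← cancel_epi i.left.isoOpensRange.hom]
    simpa using congr(($key').left)

end IsExcellentQuotient

/-! ### The quotient action and composition of quotients -/

section Quotient

variable {G H X Y Z F₁ F₂ : Over S} [GrpObj G] [GrpObj H] {aX : ModObj G X} {j : H ⟶ G}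
  {quo₁ : X ⟶ Y}

theorem exists_comp_eq_mul_mul_inv (j : H ⟶ G) [IsMonHom.Normal j] {T : Over S} (g : T ⟶ G)
    (h : T ⟶ H) : ∃ k : T ⟶ H, k ≫ j = g * (h ≫ j) * g⁻¹ := by
  have := (IsMonHom.normal_iff_normal_monoidHom (φ := j)).1 inferInstance T
  exact this.conj_mem (h ≫ j) ⟨h, rfl⟩ g

/-- The map `(g, x) ↦ quo (g • x)` only depends on `g` and `quo x`. -/
theorem whiskerLeft_quo_comp [IsMonHom.Normal j]
    (h₁ : IsExcellentQuotient (Mod.scalarRestriction j X) quo₁ F₁)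
    {s : Y ⟶ X} (hs : s ≫ quo₁ = 𝟙 Y)
    (hsurj : Surjective (H ◁ s ≫ ((Mod.scalarRestriction j X).smul : H ⊗ X ⟶ X)).left) :
    G ◁ quo₁ ≫ G ◁ s ≫ (aX.smul : G ⊗ X ⟶ X) ≫ quo₁ = (aX.smul : G ⊗ X ⟶ X) ≫ quo₁ := by
  refine h₁.comp_section_comp (isPullback_snd_whiskerLeft G quo₁) hs hsurj
    (by rw [← MonoidalCategory.whiskerLeft_comp, hs, MonoidalCategory.whiskerLeft_id])
    (by simp) _ ?_
  set act := baseChangeAct h₁.invariant (isPullback_snd_whiskerLeft G quo₁)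
  have e₁ : act ≫ fst G X = snd H (G ⊗ X) ≫ fst G X := by
    have := baseChangeAct_snd h₁.invariant (isPullback_snd_whiskerLeft G quo₁)
    simpa [act] using congr($this ≫ fst G Y)
  have e₂ : act ≫ snd G X =
      pointSmul aX (fst H (G ⊗ X) ≫ j) (snd H (G ⊗ X) ≫ snd G X) := by
    rw [baseChangeAct_fst, smul_eq_pointSmul, comp_pointSmul, pointSmul_scalarRestriction]
    simp
  have inv {T : Over S} (k : T ⟶ H) (x : T ⟶ X) : pointSmul aX (k ≫ j) x ≫ quo₁ = x ≫ quo₁ := by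
    rw [← pointSmul_scalarRestriction]
    exact pointSmul_comp_of_invariant h₁.invariant k x
  rw [smul_eq_pointSmul, ← Category.assoc, ← Category.assoc, comp_pointSmul, comp_pointSmul, e₁, e₂,
    ← mul_pointSmul]
  -- Normality gives `g h = k g` with `k` in `H`, and `quo₁` absorbs `k`.
  obtain ⟨k, hk⟩ := exists_comp_eq_mul_mul_inv j (snd H (G ⊗ X) ≫ fst G X) (fst H (G ⊗ X))
  have hk' := mul_inv_eq_iff_eq_mul.1 hk.symm
  rw [hk', mul_pointSmul, inv]

/-- The action induced on the quotient by a normal subgroup. -/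
theorem existsUnique_quotientAction [IsMonHom.Normal j]
    (h₁ : IsExcellentQuotient (Mod.scalarRestriction j X) quo₁ F₁) :
    ∃! aY : ModObj G Y, (aX.smul : G ⊗ X ⟶ X) ≫ quo₁ = G ◁ quo₁ ≫ aY.smul := by
  obtain ⟨s, hs, hsurj⟩ := h₁.exists_section
  have key := whiskerLeft_quo_comp (aX := aX) h₁ hs hsurj
  have hsG : G ◁ s ≫ G ◁ quo₁ = 𝟙 _ := by
    rw [← MonoidalCategory.whiskerLeft_comp, hs, MonoidalCategory.whiskerLeft_id]
  set m : G ⊗ Y ⟶ Y := G ◁ s ≫ (aX.smul : G ⊗ X ⟶ X) ≫ quo₁ with hm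
  have hmq {T : Over S} (g : T ⟶ G) (x : T ⟶ X) :
      lift g (x ≫ quo₁) ≫ m = pointSmul aX g x ≫ quo₁ := by
    rw [← lift_whiskerLeft, Category.assoc, key, ← Category.assoc, lift_comp_smul]
  have hms {T : Over S} (g : T ⟶ G) (y : T ⟶ Y) :
      lift g y ≫ m = pointSmul aX g (y ≫ s) ≫ quo₁ := by
    rw [← hmq, Category.assoc, hs, Category.comp_id]
  refine ⟨modObjOfPoints m ?_ ?_, key.symm, fun a ha => ?_⟩
  · rw [hms, one_pointSmul, Category.assoc, hs, Category.comp_id]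
  · intro T g h y
    rw [hms, hms h, hmq, mul_pointSmul]
  · ext1
    change (a.smul : G ⊗ Y ⟶ Y) = m
    rw [hm, ha, reassoc_of% hsG]

/-- If `quo₁ x = g • s₂ z`, then `g⁻¹ • x` lies over `s₂ z`, so it is `h • s₁ (s₂ z)` and `x = (g h)
• s₁ (s₂ z)`. Such `g, z` and `h` exist only after the surjective base changes `P` and `Q`. -/
theorem surjective_translates_comp [IsMonHom j] {aY : ModObj G Y}
    (haY : (aX.smul : G ⊗ X ⟶ X) ≫ quo₁ = G ◁ quo₁ ≫ aY.smul)
    (hinv : ((Mod.scalarRestriction j X).smul : H ⊗ X ⟶ X) ≫ quo₁ = snd H X ≫ quo₁)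
    {s₁ : Y ⟶ X} (hs₁ : s₁ ≫ quo₁ = 𝟙 Y)
    (h₁ : Surjective (H ◁ s₁ ≫ ((Mod.scalarRestriction j X).smul : H ⊗ X ⟶ X)).left)
    {s₂ : Z ⟶ Y} (h₂ : Surjective (G ◁ s₂ ≫ (aY.smul : G ⊗ Y ⟶ Y)).left) :
    Surjective (G ◁ (s₂ ≫ s₁) ≫ (aX.smul : G ⊗ X ⟶ X)).left := by
  set c₁ := H ◁ s₁ ≫ ((Mod.scalarRestriction j X).smul : H ⊗ X ⟶ X) with hc₁
  set c₂ := G ◁ s₂ ≫ (aY.smul : G ⊗ Y ⟶ Y) with hc₂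
  obtain ⟨P, x, gz, sqP⟩ : ∃ (P : Over S) (x : P ⟶ X) (gz : P ⟶ G ⊗ Z),
    IsPullback x gz quo₁ c₂ := ⟨_, _, _, .of_hasPullback _ _⟩
  obtain ⟨Q, r, hy, sqQ⟩ : ∃ (Q : Over S) (r : Q ⟶ P) (hy : Q ⟶ H ⊗ Y),
    IsPullback r hy (pointSmul aX (gz ≫ fst G Z)⁻¹ x) c₁ := ⟨_, _, _, .of_hasPullback _ _⟩
  have hx := surjective_left_of_isPullback sqP h₂
  have hr := surjective_left_of_isPullback sqQ h₁
  have eP : x ≫ quo₁ = pointSmul aY (gz ≫ fst G Z) (gz ≫ snd G Z ≫ s₂) := by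
    rw [sqP.w, hc₂, smul_eq_pointSmul, comp_pointSmul, comp_pointSmul]
    simp
  have eQ : r ≫ pointSmul aX (gz ≫ fst G Z)⁻¹ x =
      pointSmul aX (hy ≫ fst H Y ≫ j) (hy ≫ snd H Y ≫ s₁) := by
    rw [sqQ.w, hc₁, smul_eq_pointSmul, comp_pointSmul, comp_pointSmul, pointSmul_scalarRestriction]
    simp
  have ey : hy ≫ snd H Y = r ≫ gz ≫ snd G Z ≫ s₂ := by
    have e := congr($eQ ≫ quo₁)
    rw [Category.assoc, pointSmul_comp haY, eP, ← mul_pointSmul, inv_mul_cancel, one_pointSmul,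
      ← Category.assoc hy (fst H Y) j, ← pointSmul_scalarRestriction,
      pointSmul_comp_of_invariant hinv] at e
    simpa [hs₁] using e.symm
  have e : lift ((r ≫ gz ≫ fst G Z) * (hy ≫ fst H Y ≫ j)) (r ≫ gz ≫ snd G Z) ≫
      G ◁ (s₂ ≫ s₁) ≫ (aX.smul : G ⊗ X ⟶ X) = r ≫ x := by
    rw [← Category.assoc, lift_whiskerLeft, lift_comp_smul]
    have : (r ≫ gz ≫ snd G Z) ≫ s₂ ≫ s₁ = hy ≫ snd H Y ≫ s₁ := by
      simp [reassoc_of% ey]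
    rw [this, mul_pointSmul, ← eQ, comp_pointSmul, ← mul_pointSmul, GrpObj.comp_inv,
      mul_inv_cancel, one_pointSmul]
  have hsurj : Surjective (r ≫ x).left := by
    rw [Over.comp_left]
    infer_instance
  rw [← e] at hsurj
  exact surjective_left_of_comp _ _ hsurj

theorem range_appTop_comp_eq_invariantFunctions [IsMonHom j] {aY : ModObj G Y}
    (haY : (aX.smul : G ⊗ X ⟶ X) ≫ quo₁ = G ◁ quo₁ ≫ aY.smul)
    (h₁ : IsExcellentQuotient (Mod.scalarRestriction j X) quo₁ F₁) {quo₂ : Y ⟶ Z}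
    (h₂ : IsExcellentQuotient aY quo₂ F₂)
    (hinv : (aX.smul : G ⊗ X ⟶ X) ≫ quo₁ ≫ quo₂ = snd G X ≫ quo₁ ≫ quo₂)
    {s₁ : Y ⟶ X} (hs₁ : s₁ ≫ quo₁ = 𝟙 Y)
    {X' Z' : Over S} {p : X' ⟶ X} {q : X' ⟶ Z'} {b : Z' ⟶ Z}
    (sq : IsPullback p q (quo₁ ≫ quo₂) b) :
    Set.range q.left.appTop = invariantFunctions (baseChangeAct hinv sq) := by
  have sq₂ := IsPullback.of_hasPullback quo₂ b
  set pY := Limits.pullback.fst quo₂ b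
  set r := Limits.pullback.snd quo₂ b
  have ht : (p ≫ quo₁) ≫ quo₂ = q ≫ b := by rw [Category.assoc, sq.w]
  obtain ⟨t, ht₁, ht₂⟩ : ∃ t : X' ⟶ _, t ≫ pY = p ≫ quo₁ ∧ t ≫ r = q :=
    ⟨sq₂.lift _ _ ht, sq₂.lift_fst _ _ _, sq₂.lift_snd _ _ _⟩
  have sq₁ : IsPullback p t quo₁ pY := IsPullback.of_bot (by rwa [ht₂]) ht₁.symm sq₂
  apply Set.Subset.antisymm
  · rintro _ ⟨k, rfl⟩
    change _ = _
    rw [← comp_left_appTop, ← comp_left_appTop, baseChangeAct_snd]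
  · intro f hf
    have hfH : f ∈ invariantFunctions (baseChangeAct h₁.invariant sq₁) := by
      have e : baseChangeAct h₁.invariant sq₁ = j ▷ X' ≫ baseChangeAct hinv sq := by
        have e₁ : baseChangeAct h₁.invariant sq₁ ≫ p = (j ▷ X' ≫ baseChangeAct hinv sq) ≫ p := by
          rw [baseChangeAct_fst, Category.assoc, baseChangeAct_fst, ← whisker_exchange_assoc]
          rfl
        apply sq.hom_ext e₁
        rw [Category.assoc, baseChangeAct_snd, ← ht₂, baseChangeAct_snd_assoc,
          whiskerRight_snd_assoc]
      change _ = _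
      rw [e, comp_left_appTop, hf, ← comp_left_appTop, whiskerRight_snd]
    rw [← h₁.range_eq sq₁] at hfH
    obtain ⟨k, rfl⟩ := hfH
    -- The descended function is `G`-invariant because the action on the base change of `Y` is
    -- recovered from that on `X'` through the section of `t` induced by `s₁`.
    have hk : k ∈ invariantFunctions (baseChangeAct h₂.invariant sq₂) := by
      have hσ : (pY ≫ s₁) ≫ quo₁ = 𝟙 _ ≫ pY := by simp [hs₁]
      have hG : G ◁ sq₁.lift (pY ≫ s₁) (𝟙 _) hσ ≫ G ◁ t = 𝟙 _ := by
        rw [← MonoidalCategory.whiskerLeft_comp, IsPullback.lift_snd,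
          MonoidalCategory.whiskerLeft_id]
      have e : G ◁ t ≫ baseChangeAct h₂.invariant sq₂ = baseChangeAct hinv sq ≫ t := by
        apply sq₂.hom_ext
        · rw [Category.assoc, baseChangeAct_fst, Category.assoc, ht₁, baseChangeAct_fst_assoc, haY,
            ← MonoidalCategory.whiskerLeft_comp_assoc, ht₁, MonoidalCategory.whiskerLeft_comp_assoc]
        · rw [Category.assoc, baseChangeAct_snd, Category.assoc, ht₂, baseChangeAct_snd,
            whiskerLeft_snd_assoc, ht₂]
      have e' : baseChangeAct h₂.invariant sq₂ = G ◁ sq₁.lift (pY ≫ s₁) (𝟙 _) hσ ≫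
          baseChangeAct hinv sq ≫ t := by
        rw [← e, reassoc_of% hG]
      change _ = _
      have hf' : (baseChangeAct hinv sq).left.appTop (t.left.appTop k) =
        (snd G X').left.appTop (t.left.appTop k) := hf
      rw [e', comp_left_appTop, comp_left_appTop, hf', ← comp_left_appTop, ← comp_left_appTop,
        whiskerLeft_snd, Category.assoc, IsPullback.lift_snd, Category.comp_id]
    rw [← h₂.range_eq sq₂] at hk
    obtain ⟨l, rfl⟩ := hk
    exact ⟨l, by rw [← ht₂, comp_left_appTop]⟩

theorem isExcellentQuotient_comp [IsMonHom j] {aY : ModObj G Y}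
    (haY : (aX.smul : G ⊗ X ⟶ X) ≫ quo₁ = G ◁ quo₁ ≫ aY.smul)
    (h₁ : IsExcellentQuotient (Mod.scalarRestriction j X) quo₁ F₁) {quo₂ : Y ⟶ Z}
    (h₂ : IsExcellentQuotient aY quo₂ F₂) :
    IsExcellentQuotient aX (quo₁ ≫ quo₂) (F₁ ⊗ F₂) := by
  have hinv : (aX.smul : G ⊗ X ⟶ X) ≫ quo₁ ≫ quo₂ = snd G X ≫ quo₁ ≫ quo₂ := by
    have h₂' : (aY.smul : G ⊗ Y ⟶ Y) ≫ quo₂ = snd G Y ≫ quo₂ := h₂.invariant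
    rw [reassoc_of% haY, h₂', whiskerLeft_snd_assoc]
  have := h₁.flat
  have := h₂.flat
  have := h₁.surjective
  have := h₂.surjective
  obtain ⟨pt₁, iso₁, hiso₁, hsurj₁⟩ := h₁.exists_iso
  obtain ⟨pt₂, iso₂, hiso₂, hsurj₂⟩ := h₂.exists_iso
  rw [← MonoidalCategory.whiskerLeft_comp_assoc] at hsurj₁ hsurj₂
  have hs₁ : (lift (toUnit Y ≫ pt₁) (𝟙 Y) ≫ iso₁.hom) ≫ quo₁ = 𝟙 Y := by simp [hiso₁]
  refine ⟨?_, ?_, hinv, ⟨lift pt₁ pt₂, α_ F₁ F₂ Z ≪≫ whiskerLeftIso F₁ iso₂ ≪≫ iso₁, ?_, ?_⟩,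
    fun X' Z' p q b sq => range_appTop_comp_eq_invariantFunctions haY h₁ h₂ hinv hs₁ sq⟩
  · rw [Over.tensorObj_hom]
    infer_instance
  · rw [Over.tensorObj_hom]
    infer_instance
  · simp [reassoc_of% hiso₁, hiso₂]
  · have e := surjective_translates_comp haY h₁.invariant hs₁ hsurj₁ hsurj₂
    rw [← MonoidalCategory.whiskerLeft_comp_assoc]
    convert e using 4
    simp only [Iso.trans_hom, whiskerLeftIso_hom, ← Category.assoc]
    congr 1
    ext <;> simp

end Quotient

end ExcellentQuotient

theorem mainTheorem6 {S : Scheme.{u}} {G H X Y F₁ : Over S} [GrpObj G] [GrpObj H]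
    (aX : ModObj G X) (j : H ⟶ G) [IsMonHom.Normal j] (quo₁ : X ⟶ Y)
    (h₁ : ExcellentQuotient.IsExcellentQuotient (Mod.scalarRestriction j X) quo₁ F₁) :
    (∃! aY : ModObj G Y, aX.smul ≫ quo₁ = G ◁ quo₁ ≫ aY.smul) ∧
    ∀ aY : ModObj G Y, aX.smul ≫ quo₁ = G ◁ quo₁ ≫ aY.smul →
      ∀ {Z F₂ : Over S} (quo₂ : Y ⟶ Z),
        ExcellentQuotient.IsExcellentQuotient aY quo₂ F₂ →
        ExcellentQuotient.IsExcellentQuotient aX (quo₁ ≫ quo₂) (F₁ ⊗ F₂) := by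
  exact ⟨ExcellentQuotient.existsUnique_quotientAction h₁,
    fun _ haY _ _ _ h₂ => ExcellentQuotient.isExcellentQuotient_comp haY h₁ h₂⟩
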